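/- Let $\mathbb D$ be the open unit disk in $\mathbb C$ and let $dA$ be area measure on $\mathbb D$ normalized so that $A(\mathbb D)=1$. For $\alpha>-1$ put $dA_\alpha(z)=(\alpha+1)(1-|z|^2)^\alpha\,dA(z)$. For $p>0$ let $A^p_\alpha(\mathbb D)$ be the space of holomorphic functions $f$ on $\mathbb D$ with $$\|f\|_{p,\alpha}=\Bigl(\int_{\mathbb D}|f|^p\,dA_\alpha\Bigr)^{1/p}<\infty,$$ and let $A^p_\alpha(\mathbb D^2)$ be the space of holomorphic functions $F$ on the bidisk $\mathbb D^2=\mathbb D\times\mathbb D$ with $$\|F\|_{p,\alpha}=\Bigl(\int_{\mathbb D}\int_{\mathbb D}|F(z,w)|^p\,dA_\alpha(z)\,dA_\alpha(w)\Bigr)^{1/p}<\infty.$$ For $f$ holomorphic on $\mathbb D$ let $$L(f)(z,w)=\frac{f(z)-f(w)}{z-w}\quad(z\ne w),\qquad L(f)(z,z)=f'(z).$$ **Theorem.** Let $\alpha>-1$ and $p>\alpha+2$, and define $\beta$ by $2(\beta+1)=p+\alpha$. Then the symmetric lifting operator $L$ maps $A^p_\alpha(\mathbb D)$ boundedly into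 $A^p_\beta(\mathbb D^2)$: there is a constant $C$, depending only on $\alpha$ and $p$, such that for every $f\in A^p_\alpha(\mathbb D)$ we have $L(f)\in A^p_\beta(\mathbb D^2)$ and $\|L(f)\|_{p,\beta}\le C\,\|f\|_{p,\alpha}$. Moreover, the exponent $\beta$ is optimal: for every $\gamma$ with $-1<\gamma<\beta$, the operator $L$ does not map $A^p_\alpha(\mathbb D)$ into $A^p_\gamma(\mathbb D^2)$, that is, there is $f\in A^p_\alpha(\mathbb D)$ with $L(f)\notin A^p_\gamma(\mathbb D^2)$. -/

import Mathlib

open MeasureTheory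
open scoped ENNReal NNReal

noncomputable section

namespace Bergman

/-- The open unit disk in the complex plane. -/
def disk : Set ℂ := Metric.ball 0 1

/-- The open unit bidisk in `ℂ × ℂ`. -/
def bidisk : Set (ℂ × ℂ) := disk ×ˢ disk

/-- The weighted area measure `dA_α(z) = (α + 1) (1 - |z|^2)^α dA(z)` on the unit disk (and zero
off the disk), where `dA` is Lebesgue area measure divided by `π`. -/
def area (α : ℝ) : Measure ℂ :=
  (volume.restrict disk).withDensity
    fun z => ENNReal.ofReal ((α + 1) / Real.pi * (1 - ‖z‖ ^ 2) ^ α)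

/-- The norm `(∫ |f|^p dA_α)^(1/p)`, with values in `[0, ∞]`. -/
def diskNorm (p α : ℝ) (f : ℂ → ℂ) : ℝ≥0∞ :=
  (∫⁻ z, ‖f z‖ₑ ^ p ∂area α) ^ (1 / p)

/-- The norm `(∫∫ |F(z, w)|^p dA_α(z) dA_α(w))^(1/p)`, with values in `[0, ∞]`. -/
def bidiskNorm (p α : ℝ) (F : ℂ × ℂ → ℂ) : ℝ≥0∞ :=
  (∫⁻ x, ‖F x‖ₑ ^ p ∂(area α).prod (area α)) ^ (1 / p)

/-- Membership in the weighted Bergman space `A^p_α` of the disk: `f` is holomorphic in the disk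
and `∫ |f|^p dA_α < ∞`. Values of `f` off the disk play no role. -/
def MemDisk (p α : ℝ) (f : ℂ → ℂ) : Prop :=
  DifferentiableOn ℂ f disk ∧ ∫⁻ z, ‖f z‖ₑ ^ p ∂area α < ∞

/-- Membership in the weighted Bergman space `A^p_α` of the bidisk: `F` is holomorphic in the
bidisk and `∫∫ |F(z, w)|^p dA_α(z) dA_α(w) < ∞`. Values of `F` off the bidisk play no role. -/
def MemBidisk (p α : ℝ) (F : ℂ × ℂ → ℂ) : Prop :=
  DifferentiableOn ℂ F bidisk ∧ ∫⁻ x, ‖F x‖ₑ ^ p ∂(area α).prod (area α) < ∞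

open Classical in
/-- The symmetric lifting operator `L f (z, w) = (f z - f w) / (z - w)`, with its holomorphic
continuation `f' z` on the diagonal. -/
def lift (f : ℂ → ℂ) (x : ℂ × ℂ) : ℂ :=
  if x.1 = x.2 then deriv f x.1 else (f x.1 - f x.2) / (x.1 - x.2)

end Bergman

end

namespace Bergman

/-! Boundedness rests on the pointwise estimate `enorm_lift_rpow_le`: |Lf(z,w)|^p is at most a
constant times (M(z) + |f(w)|^p) |1 - z̄w|^(-p), with M(z) a mean of |f|^p over a ball about z of
radius comparable to 1 - |z|. Far from the diagonal |z - w| dominates |1 - z̄w| and the quotient is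
estimated trivially. Near the diagonal |1 - z̄w| is at most a multiple of 1 - |z|, and the Schwarz
lemma bounds the divided difference by sup |f| / (1 - |z|), the supremum being controlled by M(z).

Integrating out one variable with the Forelli–Rudin estimate `lintegral_area_kernel_le` gives the
factor (1 - |z|^2)^(β+2-p). It applies because p > β + 2 is equivalent to p > α + 2, and the choice
of β is exactly β + (β+2-p) = α, so the weight of A^p_α comes out. By Tonelli, taking local means is
bounded on L^1(dA_α) (`lintegral_localMean_le`).

For optimality take f(z) = (1 - z)^(-q/p) with q slightly below α + 2. On a product of two balls of
size about ε near 1, placed so that |f| is smaller on one by a definite factor, |Lf|^p is at least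
of order ε^(-q-p), while the product measure is at least of order ε^(2γ+4). The integral is infinite
as soon as q + p > 2γ + 4, which is compatible with q < α + 2 exactly when γ < β. -/

lemma isOpen_disk : IsOpen disk := Metric.isOpen_ball

lemma mem_disk {z : ℂ} : z ∈ disk ↔ ‖z‖ < 1 := by simp [disk]

/-! ### Mean value inequalities -/

lemma volume_ball_eq (c : ℂ) {r : ℝ} (hr : 0 ≤ r) :
    volume (Metric.ball c r) = ENNReal.ofReal (Real.pi * r ^ 2) := by
  rw [Complex.volume_ball, mul_comm Real.pi, ENNReal.ofReal_mul (by positivity),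
    ENNReal.ofReal_pow hr, ← NNReal.coe_real_pi, ENNReal.ofReal_coe_nnreal]

/-- Integration in polar coordinates. -/
lemma lintegral_polar {h : ℂ → ℝ≥0∞} (hh : Measurable h) :
    ∫⁻ u, h u = ∫⁻ ρ in Set.Ioi (0 : ℝ), ENNReal.ofReal ρ *
      ∫⁻ θ in Set.Ioo (-Real.pi) Real.pi, h (circleMap 0 ρ θ) := by
  have hm : Measurable fun x : ℝ × ℝ => h (circleMap 0 x.1 x.2) := by
    apply hh.comp
    unfold circleMap
    fun_prop
  have h1 := Complex.lintegral_comp_polarCoord_symm h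
  rw [← h1]
  have h2 : ∀ x : ℝ × ℝ, Complex.polarCoord.symm x = circleMap 0 x.1 x.2 := by
    intro x
    rw [Complex.polarCoord_symm_apply, circleMap, Complex.exp_mul_I]
    simp
  simp_rw [h2, smul_eq_mul]
  rw [polarCoord_target, Measure.volume_eq_prod, ← Measure.prod_restrict, lintegral_prod]
  · refine lintegral_congr fun ρ => ?_
    have : Measurable fun θ : ℝ => h (circleMap 0 ρ θ) :=
      hm.comp (measurable_const.prodMk measurable_id)
    dsimp only
    rw [lintegral_const_mul _ this]
  · exact ((by fun_prop : Measurable fun x : ℝ × ℝ => ENNReal.ofReal x.1).mul hm).aemeasurable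

/-- The mean value inequality on circles. -/
lemma enorm_le_lintegral_circle {f : ℂ → ℂ} {c : ℂ} {r ρ : ℝ} (hρ : 0 < ρ) (hr : ρ < r)
    (hf : DifferentiableOn ℂ f (Metric.ball c r)) :
    ENNReal.ofReal (2 * Real.pi) * ‖f c‖ₑ ≤
      ∫⁻ θ in Set.Ioo (-Real.pi) Real.pi, ‖f (c + circleMap 0 ρ θ)‖ₑ := by
  have h1 : DiffContOnCl ℂ f (Metric.ball c |ρ|) := by
    apply DifferentiableOn.diffContOnCl
    rw [closure_ball _ (by positivity)]
    apply hf.mono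
    rw [abs_of_pos hρ]
    exact Metric.closedBall_subset_ball hr
  have h2 := h1.circleAverage
  rw [Real.circleAverage_def] at h2
  have h3 : ∫ θ in (0)..(2 * Real.pi), f (circleMap c ρ θ)
      = ∫ θ in (-Real.pi)..Real.pi, f (circleMap c ρ θ) := by
    have := ((periodic_circleMap c ρ).comp f).intervalIntegral_add_eq 0 (-Real.pi)
    simpa [two_mul] using this
  rw [h3] at h2
  have h4 : (2 * Real.pi : ℝ) • f c = ∫ θ in (-Real.pi)..Real.pi, f (circleMap c ρ θ) := by
    rw [← h2, smul_smul, mul_inv_cancel₀ (by positivity), one_smul]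
  have h5 : ENNReal.ofReal (2 * Real.pi) * ‖f c‖ₑ = ‖(2 * Real.pi : ℝ) • f c‖ₑ := by
    rw [enorm_smul, Real.enorm_eq_ofReal (by positivity)]
  rw [h5, h4, intervalIntegral.integral_of_le (by linarith [Real.pi_pos]),
    integral_Ioc_eq_integral_Ioo]
  refine (enorm_integral_le_lintegral_enorm _).trans (le_of_eq ?_)
  refine lintegral_congr fun θ => ?_
  simp [circleMap]

/-- The mean value inequality on balls. -/
lemma enorm_le_lintegral_ball {f : ℂ → ℂ} {c : ℂ} {r : ℝ} (hr : 0 < r)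
    (hf : DifferentiableOn ℂ f (Metric.ball c r)) :
    ENNReal.ofReal (Real.pi * r ^ 2) * ‖f c‖ₑ ≤ ∫⁻ u in Metric.ball c r, ‖f u‖ₑ := by
  -- Cutting `f` off outside the ball makes it globally measurable, as `lintegral_polar` requires.
  set g : ℂ → ℂ := (Metric.ball c r).indicator f with hg
  have hgm : Measurable g := by
    classical
    rw [hg, ← Set.piecewise_eq_indicator]
    exact ContinuousOn.measurable_piecewise hf.continuousOn continuousOn_const
      Metric.isOpen_ball.measurableSet
  have h1 : ∫⁻ u in Metric.ball c r, ‖f u‖ₑ = ∫⁻ u, ‖g (c + u)‖ₑ := by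
    rw [lintegral_add_left_eq_self (fun u => ‖g u‖ₑ) c, ← lintegral_indicator measurableSet_ball]
    refine lintegral_congr fun u => ?_
    by_cases hu : u ∈ Metric.ball c r <;> simp [hg, hu]
  rw [h1, lintegral_polar (by fun_prop)]
  have h2 : ∀ ρ ∈ Set.Ioo (0 : ℝ) r, ENNReal.ofReal ρ * (ENNReal.ofReal (2 * Real.pi) * ‖f c‖ₑ) ≤
      ENNReal.ofReal ρ *
      ∫⁻ θ in Set.Ioo (-Real.pi) Real.pi, ‖g (c + circleMap 0 ρ θ)‖ₑ := by
    intro ρ hρ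
    gcongr
    refine (enorm_le_lintegral_circle hρ.1 hρ.2 hf).trans (le_of_eq ?_)
    refine lintegral_congr fun θ => ?_
    rw [hg, Set.indicator_of_mem]
    simp [abs_of_pos hρ.1, hρ.2]
  calc _ = ∫⁻ ρ in Set.Ioo (0 : ℝ) r, ENNReal.ofReal ρ * (ENNReal.ofReal (2 * Real.pi) * ‖f c‖ₑ) := by
        rw [lintegral_mul_const _ (by fun_prop), ← ofReal_integral_eq_lintegral_ofReal,
          ← integral_Ioc_eq_integral_Ioo, ← intervalIntegral.integral_of_le hr.le, integral_id,
          ← mul_assoc, ← ENNReal.ofReal_mul (by nlinarith)]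
        · congr 2; ring
        · exact (continuous_id.integrableOn_Icc (a := 0) (b := r)).mono_set Set.Ioo_subset_Icc_self
        · filter_upwards [self_mem_ae_restrict measurableSet_Ioo] with x hx using hx.1.le
    _ ≤ ∫⁻ ρ in Set.Ioo (0 : ℝ) r, ENNReal.ofReal ρ *
      ∫⁻ θ in Set.Ioo (-Real.pi) Real.pi, ‖g (c + circleMap 0 ρ θ)‖ₑ :=
        setLIntegral_mono' measurableSet_Ioo h2
    _ ≤ _ := lintegral_mono_set Set.Ioo_subset_Ioi_self

/-- The mean value inequality for `|f|^p`. -/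
lemma enorm_rpow_le_lintegral_ball {f : ℂ → ℂ} {c : ℂ} {r p : ℝ} (hr : 0 < r) (hp : 1 < p)
    (hf : DifferentiableOn ℂ f (Metric.ball c r)) :
    ‖f c‖ₑ ^ p ≤ ENNReal.ofReal (1 / (Real.pi * r ^ 2)) *
      ∫⁻ u in Metric.ball c r, ‖f u‖ₑ ^ p := by
  have h1 := enorm_le_lintegral_ball hr hf
  have hpq := Real.HolderConjugate.conjExponent hp
  set q := Real.conjExponent p
  have hfm : AEMeasurable (fun u => ‖f u‖ₑ) (volume.restrict (Metric.ball c r)) :=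
    (hf.continuousOn.aemeasurable measurableSet_ball).enorm
  -- Hölder against the constant 1; after raising to the power p, the area contributes A^(p/q) =
  -- A^(p-1).
  have h2 := ENNReal.lintegral_mul_le_Lp_mul_Lq (volume.restrict (Metric.ball c r)) hpq hfm
    (aemeasurable_const (b := (1 : ℝ≥0∞)))
  have hA := volume_ball_eq c hr.le
  simp only [Pi.mul_apply, mul_one, ENNReal.one_rpow, lintegral_one, Measure.restrict_apply_univ,
    hA] at h2
  have h3 := h1.trans h2
  set A := ENNReal.ofReal (Real.pi * r ^ 2) with hAdef
  set I := ∫⁻ u in Metric.ball c r, ‖f u‖ₑ ^ p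
  have hA0 : A ≠ 0 := by
    rw [hAdef, Ne, ENNReal.ofReal_eq_zero, not_le]; positivity
  have hAt : A ≠ ⊤ := ENNReal.ofReal_ne_top
  have h4 := ENNReal.rpow_le_rpow h3 (by linarith : (0 : ℝ) ≤ p)
  have hp0 : (0 : ℝ) ≤ p := by linarith
  rw [ENNReal.mul_rpow_of_nonneg _ _ hp0, ENNReal.mul_rpow_of_nonneg _ _ hp0, ← ENNReal.rpow_mul,
    ← ENNReal.rpow_mul, one_div_mul_cancel (by linarith), ENNReal.rpow_one] at h4
  have hq : 1 / q * p = p - 1 := by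
    have := hpq.inv_add_inv_eq_one
    have hp' : p ≠ 0 := by linarith
    have : 1 / q = 1 - p⁻¹ := by rw [one_div]; linarith
    rw [this]; field_simp
  rw [hq] at h4
  have h5 : ENNReal.ofReal (1 / (Real.pi * r ^ 2)) = A⁻¹ := by
    rw [one_div, ENNReal.ofReal_inv_of_pos (by positivity)]
  rw [h5]
  have h6 : A ^ p = A ^ (p - 1) * A := by
    conv_rhs => rw [← ENNReal.rpow_one A, ← ENNReal.rpow_mul, one_mul, ← ENNReal.rpow_add _ _ hA0 hAt,
      sub_add_cancel]
  have h7 : A ^ (p - 1) ≠ 0 := by simp [hA0, hAt]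
  have h8 : A ^ (p - 1) ≠ ⊤ := by simp [hA0, hAt]
  rw [h6, mul_comm I, mul_assoc, ENNReal.mul_le_mul_iff_right h7 h8] at h4
  rw [mul_comm, ← div_eq_mul_inv, ENNReal.le_div_iff_mul_le (by simp [hA0]) (by simp [hAt]), mul_comm]
  exact h4

/-! ### Holomorphy of the lift -/

lemma lift_eq_dslope (f : ℂ → ℂ) (z w : ℂ) : lift f (z, w) = dslope f z w := by
  by_cases h : z = w
  · subst h; simp [lift]
  · rw [lift, dslope_of_ne _ (Ne.symm h), slope_def_field]
    simp only [h, if_false]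
    rw [← neg_sub (f w), ← neg_sub w, neg_div_neg_eq]

/-- The divided difference of f'(a) z + c (z - a)^2 is the affine function f'(a) + c ((z - a) + (w -
a)). With c = f''(a)/2 the remainder `h` has derivative o(|z - a|), so the mean value inequality
makes its divided difference o(‖v‖). -/
lemma differentiableAt_lift_diag {f : ℂ → ℂ} {a : ℂ} (hf : AnalyticAt ℂ f a) :
    DifferentiableAt ℂ (lift f) (a, a) := by
  set c := deriv (deriv f) a / 2 with hc
  let L : ℂ × ℂ →L[ℂ] ℂ := c • (ContinuousLinearMap.fst ℂ ℂ ℂ + ContinuousLinearMap.snd ℂ ℂ ℂ)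
  have hL : HasFDerivAt (lift f) L (a, a) := by
    rw [hasFDerivAt_iff_isLittleO_nhds_zero, Asymptotics.isLittleO_iff]
    intro ε hε
    have hd := hf.deriv.differentiableAt.hasDerivAt
    rw [hasDerivAt_iff_isLittleO, Asymptotics.isLittleO_iff] at hd
    have hev := (hd hε).and hf.eventually_analyticAt
    obtain ⟨δ, hδ, hball⟩ := Metric.eventually_nhds_iff_ball.1 hev
    set h : ℂ → ℂ := fun z => f z - deriv f a * z - c * (z - a) ^ 2 with hh
    have hder : ∀ z ∈ Metric.ball a δ,
        HasDerivAt h (deriv f z - deriv f a - (z - a) * deriv (deriv f) a) z := by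
      intro z hz
      have h1 := (hball z hz).2.differentiableAt.hasDerivAt
      have h2 := (h1.sub ((hasDerivAt_id z).const_mul (deriv f a))).sub
        ((((hasDerivAt_id z).sub_const a).pow 2).const_mul c)
      exact h2.congr_deriv (by simp [hc]; ring)
    filter_upwards [Metric.ball_mem_nhds (0 : ℂ × ℂ) hδ] with v hv
    have hvδ : ‖v‖ < δ := by simpa using hv
    have hv1 : ‖v.1‖ ≤ ‖v‖ := norm_fst_le v
    have hv2 : ‖v.2‖ ≤ ‖v‖ := norm_snd_le v
    have hsub : ∀ z ∈ Metric.closedBall a ‖v‖, z ∈ Metric.ball a δ := fun z hz =>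
      Metric.closedBall_subset_ball hvδ hz
    have hm1 : a + v.1 ∈ Metric.closedBall a ‖v‖ := by simpa using hv1
    have hm2 : a + v.2 ∈ Metric.closedBall a ‖v‖ := by simpa using hv2
    have hbd : ∀ z ∈ Metric.closedBall a ‖v‖,
        ‖deriv f z - deriv f a - (z - a) * deriv (deriv f) a‖ ≤ ε * ‖v‖ := by
      intro z hz
      have := (hball z (hsub z hz)).1
      rw [smul_eq_mul] at this
      refine this.trans ?_
      gcongr
      simpa [dist_eq_norm] using hz
    have hdiag : lift f (a, a) = deriv f a := by simp [lift]
    rw [hdiag]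
    by_cases hne : v.1 = v.2
    · have : lift f ((a, a) + v) = deriv f (a + v.1) := by simp [lift, hne]
      rw [this]
      have h2 : deriv f (a + v.1) - deriv f a - L v =
          deriv f (a + v.1) - deriv f a - (a + v.1 - a) * deriv (deriv f) a := by
        simp [L, hc, ← hne]; ring
      rw [h2]
      exact hbd _ hm1
    · have hne' : v.1 - v.2 ≠ 0 := sub_ne_zero.2 hne
      have h0 : lift f ((a, a) + v) = (f (a + v.1) - f (a + v.2)) / (v.1 - v.2) := by
        simp [lift, hne]
      have h1 := (convex_closedBall a ‖v‖).norm_image_sub_le_of_norm_hasDerivWithin_le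
        (fun z hz => (hder z (hsub z hz)).hasDerivWithinAt) hbd hm2 hm1
      have h2 : lift f ((a, a) + v) - deriv f a - L v
          = (h (a + v.1) - h (a + v.2)) / (v.1 - v.2) := by
        rw [h0, hh]; simp [L]; field_simp; ring
      rw [h2, norm_div, div_le_iff₀ (by positivity)]
      simpa using h1
  exact hL.differentiableAt

lemma differentiableOn_lift {f : ℂ → ℂ} (hf : DifferentiableOn ℂ f disk) :
    DifferentiableOn ℂ (lift f) bidisk := by
  rintro ⟨z, w⟩ ⟨hz, hw⟩
  apply DifferentiableAt.differentiableWithinAt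
  simp only at hz hw
  by_cases h : z = w
  · subst h
    exact differentiableAt_lift_diag (hf.analyticAt (isOpen_disk.mem_nhds hz))
  · have hzf := hf.differentiableAt (isOpen_disk.mem_nhds hz)
    have hwf := hf.differentiableAt (isOpen_disk.mem_nhds hw)
    have h1 : DifferentiableAt ℂ (fun x : ℂ × ℂ => (f x.1 - f x.2) / (x.1 - x.2)) (z, w) := by
      have h1 : DifferentiableAt ℂ (fun x : ℂ × ℂ => f x.1) (z, w) :=
        DifferentiableAt.comp (z, w) hzf differentiableAt_fst
      have h2 : DifferentiableAt ℂ (fun x : ℂ × ℂ => f x.2) (z, w) :=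
        DifferentiableAt.comp (z, w) hwf differentiableAt_snd
      have h3 : DifferentiableAt ℂ (fun x : ℂ × ℂ => x.1 - x.2) (z, w) := by fun_prop
      simp_rw [div_eq_mul_inv]
      exact (h1.fun_sub h2).fun_mul (h3.fun_inv (sub_ne_zero.2 h))
    refine h1.congr_of_eventuallyEq ?_
    have : ∀ᶠ x : ℂ × ℂ in nhds (z, w), x.1 ≠ x.2 :=
      (isOpen_ne_fun continuous_fst continuous_snd).mem_nhds h
    filter_upwards [this] with x hx
    simp [lift, hx]

/-! ### Kernel integrals and the Forelli–Rudin estimate -/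

lemma rpow_le_of_comparable {x y K : ℝ} (b : ℝ) (hx : 0 < x) (hy : 0 < y) (hxy : x ≤ K * y)
    (hyx : y ≤ K * x) : x ^ b ≤ K ^ |b| * y ^ b := by
  have hK : 0 < K := by
    by_contra h
    push Not at h
    nlinarith
  rcases le_total 0 b with hb | hb
  · rw [abs_of_nonneg hb, ← Real.mul_rpow hK.le hy.le]
    exact Real.rpow_le_rpow hx.le hxy hb
  · rw [abs_of_nonpos hb, Real.rpow_neg hK.le, ← Real.inv_rpow hK.le,
      ← Real.mul_rpow (by positivity) hy.le]
    refine Real.rpow_le_rpow_of_nonpos (by positivity) ?_ hb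
    rw [inv_mul_le_iff₀ hK]
    exact hyx

lemma measurable_weight (b : ℝ) :
    Measurable fun z : ℂ => ENNReal.ofReal ((b + 1) / Real.pi * (1 - ‖z‖ ^ 2) ^ b) := by
  fun_prop

lemma lintegral_area (b : ℝ) (h : ℂ → ℝ≥0∞) :
    ∫⁻ z, h z ∂area b =
      ∫⁻ z in disk, ENNReal.ofReal ((b + 1) / Real.pi * (1 - ‖z‖ ^ 2) ^ b) * h z := by
  rw [area, lintegral_withDensity_eq_lintegral_mul_non_measurable _ (measurable_weight b)]
  · rfl
  · exact Filter.Eventually.of_forall fun x => ENNReal.ofReal_lt_top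

lemma lintegral_rpow_Ioo {b d : ℝ} (hb : -1 < b) (hd : 0 < d) :
    ∫⁻ s in Set.Ioc (0 : ℝ) d, ENNReal.ofReal (s ^ b) =
      ENNReal.ofReal (d ^ (b + 1) / (b + 1)) := by
  have hi := intervalIntegral.intervalIntegrable_rpow' (a := 0) (b := d) hb
  rw [← ofReal_integral_eq_lintegral_ofReal, ← intervalIntegral.integral_of_le hd.le,
    integral_rpow (Or.inl hb), Real.zero_rpow (by linarith), sub_zero]
  · exact (intervalIntegrable_iff_integrableOn_Ioc_of_le hd.le).1 hi
  · filter_upwards [self_mem_ae_restrict measurableSet_Ioc] with x hx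
      using Real.rpow_nonneg hx.1.le _

lemma lintegral_rpow_Ioi {b d : ℝ} (hb : b < -1) (hd : 0 < d) :
    ∫⁻ s in Set.Ioi d, ENNReal.ofReal (s ^ b) = ENNReal.ofReal (-d ^ (b + 1) / (b + 1)) := by
  rw [← ofReal_integral_eq_lintegral_ofReal, integral_Ioi_rpow_of_lt hb hd]
  · exact integrableOn_Ioi_rpow_of_lt hb hd
  · filter_upwards [self_mem_ae_restrict measurableSet_Ioi] with x hx
      using Real.rpow_nonneg (hd.le.trans (le_of_lt hx)) _

/-- Split at s = d, using s + d ≥ d below and s + d ≥ s above. The two hypotheses are convergence at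
0 and at infinity. -/
lemma lintegral_rpow_mul_add_rpow_le {b q : ℝ} (hb : -1 < b) (hq : b + 1 < q) :
    ∃ C : ℝ≥0, ∀ d : ℝ, 0 < d →
      ∫⁻ s in Set.Ioi (0 : ℝ), ENNReal.ofReal (s ^ b * (s + d) ^ (-q)) ≤
        C * ENNReal.ofReal (d ^ (b + 1 - q)) := by
  refine ⟨⟨1 / (b + 1) + 1 / (q - b - 1), add_nonneg (one_div_nonneg.2 (by linarith))
    (one_div_nonneg.2 (by linarith))⟩, fun d hd => ?_⟩
  have hun : Set.Ioi (0 : ℝ) = Set.Ioc 0 d ∪ Set.Ioi d := (Set.Ioc_union_Ioi_eq_Ioi hd.le).symm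
  have h1 : ∫⁻ s in Set.Ioc (0 : ℝ) d, ENNReal.ofReal (s ^ b * (s + d) ^ (-q)) ≤
      ENNReal.ofReal (d ^ (b + 1 - q) * (1 / (b + 1))) := by
    calc _ ≤ ∫⁻ s in Set.Ioc (0 : ℝ) d, ENNReal.ofReal (s ^ b) * ENNReal.ofReal (d ^ (-q)) := by
          refine setLIntegral_mono' measurableSet_Ioc fun s hs => ?_
          have := Real.rpow_nonneg hs.1.le b
          rw [← ENNReal.ofReal_mul this]
          gcongr ENNReal.ofReal (_ * ?_)
          exact Real.rpow_le_rpow_of_nonpos hd (by linarith [hs.1]) (by linarith)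
      _ = _ := by
          rw [lintegral_mul_const _ (by fun_prop), lintegral_rpow_Ioo hb hd,
            ← ENNReal.ofReal_mul (div_nonneg (by positivity) (by linarith))]
          congr 1
          rw [show b + 1 - q = (b + 1) + (-q) by ring, Real.rpow_add hd (b + 1) (-q)]
          generalize d ^ (b + 1) = u
          ring
  have h2 : ∫⁻ s in Set.Ioi d, ENNReal.ofReal (s ^ b * (s + d) ^ (-q)) ≤
      ENNReal.ofReal (d ^ (b + 1 - q) * (1 / (q - b - 1))) := by
    calc _ ≤ ∫⁻ s in Set.Ioi d, ENNReal.ofReal (s ^ (b - q)) := by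
          refine setLIntegral_mono' measurableSet_Ioi fun s hs => ?_
          have hs0 : 0 < s := hd.trans hs
          rw [sub_eq_add_neg b q, Real.rpow_add hs0]
          gcongr ENNReal.ofReal (_ * ?_)
          exact Real.rpow_le_rpow_of_nonpos hs0 (by linarith) (by linarith)
      _ = _ := by
          rw [lintegral_rpow_Ioi (by linarith) hd]
          congr 1
          rw [show b + 1 - q = b - q + 1 by ring, show q - b - 1 = -(b - q + 1) by ring,
            neg_div, one_div, inv_neg]
          ring
  rw [hun]
  refine (lintegral_union_le _ _ _).trans ((add_le_add h1 h2).trans (le_of_eq ?_))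
  have e1 : 0 ≤ 1 / (b + 1) := one_div_nonneg.2 (by linarith)
  have e2 : 0 ≤ 1 / (q - b - 1) := one_div_nonneg.2 (by linarith)
  have e3 : 0 ≤ d ^ (b + 1 - q) := by positivity
  rw [← ENNReal.ofReal_add (mul_nonneg e3 e1) (mul_nonneg e3 e2), ← mul_add,
    mul_comm, ENNReal.ofReal_mul (add_nonneg e1 e2)]
  congr 1
  exact ENNReal.ofReal_eq_coe_nnreal (add_nonneg e1 e2)

lemma lintegral_abs_add_rpow_le {q : ℝ} (hq : 1 < q) :
    ∃ C : ℝ≥0, ∀ d : ℝ, 0 < d →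
      ∫⁻ θ : ℝ, ENNReal.ofReal ((|θ| + d) ^ (-q)) ≤ C * ENNReal.ofReal (d ^ (1 - q)) := by
  obtain ⟨C, hC⟩ := lintegral_rpow_mul_add_rpow_le (b := 0) (q := q) (by norm_num) (by linarith)
  refine ⟨2 * C, fun d hd => ?_⟩
  have h1 := hC d hd
  simp only [Real.rpow_zero, one_mul, zero_add] at h1
  have h2 : ∫⁻ θ in Set.Ioi (0 : ℝ), ENNReal.ofReal ((|θ| + d) ^ (-q)) ≤
      C * ENNReal.ofReal (d ^ (1 - q)) := by
    refine le_trans (le_of_eq ?_) h1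
    refine setLIntegral_congr_fun measurableSet_Ioi fun s hs => ?_
    simp only [abs_of_pos (Set.mem_Ioi.1 hs)]
  have h3 : ∫⁻ θ in Set.Iic (0 : ℝ), ENNReal.ofReal ((|θ| + d) ^ (-q)) ≤
      C * ENNReal.ofReal (d ^ (1 - q)) := by
    refine le_trans (le_of_eq ?_) h2
    rw [← lintegral_indicator measurableSet_Iic, ← lintegral_neg_eq_self,
      ← setLIntegral_congr Ioi_ae_eq_Ici.symm, ← lintegral_indicator measurableSet_Ici]
    refine lintegral_congr fun s => ?_
    by_cases hs : 0 ≤ s <;> simp [Set.indicator, hs]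
  rw [← setLIntegral_univ, ← Set.Iic_union_Ioi (a := (0 : ℝ))]
  refine (lintegral_union_le _ _ _).trans ((add_le_add h3 h2).trans (le_of_eq ?_))
  push_cast
  ring

/-- From |1 - x r e^(iθ)|^2 = (1 - xr)^2 + 2xr (1 - cos θ): if xr ≥ 1/2, the quadratic lower bound
for 1 - cos θ controls |θ|; if xr ≤ 1/2, the norm is at least 1/2 and |θ| ≤ π ≤ 4 suffices. The
constant is 8 + 1 + 1. -/
lemma add_abs_le_norm_one_sub {x r θ : ℝ} (hx0 : 0 ≤ x) (hx : x ≤ 1) (hr0 : 0 ≤ r) (hr : r ≤ 1)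
    (hθ : |θ| ≤ Real.pi) :
    |θ| + (1 - r + (1 - x)) ≤ 10 * ‖1 - (x : ℂ) * circleMap 0 r θ‖ := by
  set N := ‖1 - (x : ℂ) * circleMap 0 r θ‖ with hN
  have hxr : x * r ≤ 1 := by nlinarith
  have hxr0 : 0 ≤ x * r := by positivity
  have h1 : 1 - x * r ≤ N := by
    have h := norm_sub_norm_le (1 : ℂ) ((x : ℂ) * circleMap 0 r θ)
    simpa [abs_of_nonneg hx0, abs_of_nonneg hr0] using h
  have h2 : N ^ 2 = (1 - x * r) ^ 2 + 2 * (x * r) * (1 - Real.cos θ) := by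
    rw [hN, ← Complex.normSq_eq_norm_sq, circleMap, Complex.exp_mul_I, ← Complex.ofReal_cos,
      ← Complex.ofReal_sin, Complex.normSq_apply]
    simp [Complex.cos_ofReal_re, Complex.sin_ofReal_re]
    linear_combination x ^ 2 * r ^ 2 * Real.sin_sq_add_cos_sq θ
  have h3 := Real.cos_le_one_sub_mul_cos_sq hθ
  have hN0 : 0 ≤ N := norm_nonneg _
  have hpi : Real.pi ≤ 4 := Real.pi_le_four
  have h4 : |θ| ≤ 8 * N := by
    rcases le_total (1 / 2) (x * r) with h | h
    · have h5 : 2 / Real.pi ^ 2 * θ ^ 2 ≤ N ^ 2 := by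
        rw [h2]
        nlinarith [sq_nonneg (1 - x * r), Real.cos_le_one θ]
      have h6 : 2 / (4 : ℝ) ^ 2 ≤ 2 / Real.pi ^ 2 := by gcongr
      refine abs_le_of_sq_le_sq ?_ (by linarith)
      nlinarith [sq_nonneg θ]
    · linarith
  have h5 : 1 - r ≤ N := by nlinarith
  have h6 : 1 - x ≤ N := by nlinarith
  linarith

/-- The angular integral of (|θ| + e)^(-q) gains one power of e, and s = 1 - r is the radial
variable. The endpoint x = 1 is included so that the same bound gives the norm of the test function.
-/
lemma lintegral_disk_kernel_real_le {q : ℝ} (hq : 1 < q) (b : ℝ) :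
    ∃ C : ℝ≥0, ∀ x : ℝ, 0 ≤ x → x ≤ 1 →
      ∫⁻ w in disk, ENNReal.ofReal ((1 - ‖w‖ ^ 2) ^ b * ‖1 - (x : ℂ) * w‖ ^ (-q)) ≤
        C * ∫⁻ s in Set.Ioo (0 : ℝ) 1, ENNReal.ofReal (s ^ b * (s + (1 - x)) ^ (1 - q)) := by
  obtain ⟨C, hC⟩ := lintegral_abs_add_rpow_le hq
  refine ⟨Real.toNNReal (2 ^ |b| * 10 ^ q) * C, fun x hx0 hx => ?_⟩
  rw [← lintegral_indicator isOpen_disk.measurableSet, lintegral_polar]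
  swap
  · exact Measurable.indicator (by fun_prop) isOpen_disk.measurableSet
  set g : ℝ → ℝ≥0∞ := fun s => (Real.toNNReal (2 ^ |b| * 10 ^ q) * C : ℝ≥0) *
    ENNReal.ofReal (s ^ b * (s + (1 - x)) ^ (1 - q)) with hg
  have hgm : Measurable g := by fun_prop
  have key : ∀ r ∈ Set.Ioi (0 : ℝ), ENNReal.ofReal r * ∫⁻ θ in Set.Ioo (-Real.pi) Real.pi,
      disk.indicator (fun w => ENNReal.ofReal ((1 - ‖w‖ ^ 2) ^ b * ‖1 - (x : ℂ) * w‖ ^ (-q)))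
        (circleMap 0 r θ) ≤ (Set.Ioo (0 : ℝ) 1).indicator g (1 - r) := by
    intro r hr
    have hr0 : 0 < r := hr
    by_cases hr1 : r < 1
    swap
    · have : ∀ θ, circleMap 0 r θ ∉ disk := by
        intro θ
        rw [mem_disk]
        simpa [abs_of_pos hr0] using hr1
      simp [this]
    have hin : ∀ θ, circleMap 0 r θ ∈ disk := by
      intro θ
      rw [mem_disk]
      simpa [abs_of_pos hr0] using hr1
    rw [Set.indicator_of_mem (by constructor <;> linarith)]
    simp only [Set.indicator_of_mem (hin _), norm_circleMap_zero, sq_abs]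
    set e := 1 - r + (1 - x) with he
    have he0 : 0 < e := by linarith
    -- The Jacobian r is bounded by 1.
    calc _ ≤ 1 * ∫⁻ θ in Set.Ioo (-Real.pi) Real.pi,
          ENNReal.ofReal (2 ^ |b| * 10 ^ q * (1 - r) ^ b) * ENNReal.ofReal ((|θ| + e) ^ (-q)) := by
          gcongr ?_ * ?_
          · exact ENNReal.ofReal_le_one.2 hr1.le
          refine setLIntegral_mono' measurableSet_Ioo fun θ hθ => ?_
          have h1r : 0 < 1 - r := by linarith
          rw [← ENNReal.ofReal_mul (by positivity)]
          apply ENNReal.ofReal_le_ofReal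
          have k1 : (1 - r ^ 2) ^ b ≤ 2 ^ |b| * (1 - r) ^ b :=
            rpow_le_of_comparable b (by nlinarith) h1r (by nlinarith) (by nlinarith)
          have k2 := add_abs_le_norm_one_sub hx0 hx hr0.le hr1.le (abs_le.2 ⟨hθ.1.le, hθ.2.le⟩)
          have k3 : ‖1 - (x : ℂ) * circleMap 0 r θ‖ ^ (-q) ≤ 10 ^ q * (|θ| + e) ^ (-q) := by
            have : ((10 : ℝ)⁻¹) ^ (-q) = 10 ^ q := by
              rw [Real.inv_rpow (by norm_num), Real.rpow_neg (by norm_num), inv_inv]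
            rw [← this, ← Real.mul_rpow (by norm_num) (by positivity)]
            refine Real.rpow_le_rpow_of_nonpos (by positivity) ?_ (by linarith)
            linarith
          calc _ ≤ (2 ^ |b| * (1 - r) ^ b) * (10 ^ q * (|θ| + e) ^ (-q)) := by gcongr
            _ = _ := by ring
      _ ≤ 1 * ∫⁻ θ : ℝ,
          ENNReal.ofReal (2 ^ |b| * 10 ^ q * (1 - r) ^ b) * ENNReal.ofReal ((|θ| + e) ^ (-q)) := by
          gcongr
          exact Measure.restrict_le_self
      _ ≤ ENNReal.ofReal (2 ^ |b| * 10 ^ q * (1 - r) ^ b) * (C * ENNReal.ofReal (e ^ (1 - q))) := by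
          rw [one_mul, lintegral_const_mul _ (by fun_prop)]
          gcongr
          exact hC e he0
      _ = g (1 - r) := by
          have h1r : 0 < 1 - r := by linarith
          rw [hg]
          simp only
          rw [ENNReal.ofReal_mul (by positivity), ENNReal.ofReal_mul (p := (1 - r) ^ b)
            (by positivity), ← he]
          push_cast
          rw [ENNReal.ofReal]
          ring
  calc _ ≤ ∫⁻ r in Set.Ioi (0 : ℝ), (Set.Ioo (0 : ℝ) 1).indicator g (1 - r) :=
        setLIntegral_mono' measurableSet_Ioi key
    _ ≤ ∫⁻ r : ℝ, (Set.Ioo (0 : ℝ) 1).indicator g (1 - r) :=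
        lintegral_mono' Measure.restrict_le_self le_rfl
    _ = ∫⁻ s in Set.Ioo (0 : ℝ) 1, g s := by
        rw [lintegral_sub_left_eq_self (fun s => (Set.Ioo (0 : ℝ) 1).indicator g s) 1,
          lintegral_indicator measurableSet_Ioo]
    _ = _ := lintegral_const_mul _ (by fun_prop)

/-- Rotation invariance of Lebesgue measure reduces the kernel to real z. -/
lemma lintegral_disk_kernel_eq (z : ℂ) (b q : ℝ) :
    ∫⁻ w in disk, ENNReal.ofReal ((1 - ‖w‖ ^ 2) ^ b * ‖1 - (starRingEnd ℂ) z * w‖ ^ (-q)) =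
      ∫⁻ w in disk, ENNReal.ofReal ((1 - ‖w‖ ^ 2) ^ b * ‖1 - (‖z‖ : ℂ) * w‖ ^ (-q)) := by
  obtain ⟨u, hu⟩ : ∃ u : Circle, (starRingEnd ℂ) z = ‖z‖ * (u : ℂ) := by
    refine ⟨Circle.exp (-z.arg), ?_⟩
    conv_lhs => rw [← Complex.norm_mul_exp_arg_mul_I z]
    rw [map_mul, Complex.conj_ofReal, ← Complex.exp_conj, Circle.coe_exp]
    simp
  rw [← lintegral_indicator isOpen_disk.measurableSet,
    ← lintegral_indicator isOpen_disk.measurableSet,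
    ← (rotation u).measurePreserving.lintegral_comp_emb
      (rotation u).toHomeomorph.measurableEmbedding
      (disk.indicator fun w => ENNReal.ofReal ((1 - ‖w‖ ^ 2) ^ b * ‖1 - (‖z‖ : ℂ) * w‖ ^ (-q)))]
  refine lintegral_congr fun w => ?_
  have h1 : rotation u w ∈ disk ↔ w ∈ disk := by
    rw [mem_disk, mem_disk, LinearIsometryEquiv.norm_map]
  have h2 : (‖z‖ : ℂ) * rotation u w = (starRingEnd ℂ) z * w := by
    rw [hu, rotation_apply, mul_assoc]
  by_cases hw : w ∈ disk
  · rw [Set.indicator_of_mem hw, Set.indicator_of_mem (h1.2 hw), h2, LinearIsometryEquiv.norm_map]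
  · rw [Set.indicator_of_notMem hw, Set.indicator_of_notMem (fun h => hw (h1.1 h))]

lemma lintegral_area_kernel (z : ℂ) {b : ℝ} (hb : -1 < b) (q : ℝ) :
    ∫⁻ w, ENNReal.ofReal (‖1 - (starRingEnd ℂ) z * w‖ ^ (-q)) ∂area b =
      ENNReal.ofReal ((b + 1) / Real.pi) *
      ∫⁻ w in disk, ENNReal.ofReal ((1 - ‖w‖ ^ 2) ^ b * ‖1 - (‖z‖ : ℂ) * w‖ ^ (-q)) := by
  rw [lintegral_area, ← lintegral_disk_kernel_eq, ← lintegral_const_mul _ (by fun_prop)]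
  refine setLIntegral_congr_fun isOpen_disk.measurableSet fun w hw => ?_
  have h1 : 0 ≤ (b + 1) / Real.pi := div_nonneg (by linarith) Real.pi_pos.le
  have h2 : 0 ≤ 1 - ‖w‖ ^ 2 := by
    have := mem_disk.1 hw
    nlinarith [norm_nonneg w]
  rw [← ENNReal.ofReal_mul (by positivity), ← ENNReal.ofReal_mul (by positivity), mul_assoc]

/-- The Forelli–Rudin estimate. -/
lemma lintegral_area_kernel_le {b q : ℝ} (hb : -1 < b) (hq : b + 2 < q) :
    ∃ C : ℝ≥0, ∀ z ∈ disk,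
      ∫⁻ w, ENNReal.ofReal (‖1 - (starRingEnd ℂ) z * w‖ ^ (-q)) ∂area b ≤
        C * ENNReal.ofReal ((1 - ‖z‖ ^ 2) ^ (b + 2 - q)) := by
  obtain ⟨C₁, h₁⟩ := lintegral_disk_kernel_real_le (q := q) (by linarith) b
  obtain ⟨C₂, h₂⟩ := lintegral_rpow_mul_add_rpow_le (b := b) (q := q - 1) hb (by linarith)
  refine ⟨Real.toNNReal ((b + 1) / Real.pi) * C₁ * C₂ * Real.toNNReal (2 ^ |b + 2 - q|),
    fun z hz => ?_⟩
  have hz1 : ‖z‖ < 1 := mem_disk.1 hz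
  have hz0 := norm_nonneg z
  rw [lintegral_area_kernel z hb]
  calc _ ≤ ENNReal.ofReal ((b + 1) / Real.pi) * (C₁ * (C₂ *
        ENNReal.ofReal ((1 - ‖z‖) ^ (b + 1 - (q - 1))))) := by
        gcongr
        refine (h₁ ‖z‖ hz0 hz1.le).trans ?_
        gcongr
        refine le_trans ?_ (h₂ (1 - ‖z‖) (by linarith))
        refine (lintegral_mono_set Set.Ioo_subset_Ioi_self).trans (le_of_eq ?_)
        rw [neg_sub]
    _ ≤ ENNReal.ofReal ((b + 1) / Real.pi) * (C₁ * (C₂ *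
        (ENNReal.ofReal (2 ^ |b + 2 - q|) * ENNReal.ofReal ((1 - ‖z‖ ^ 2) ^ (b + 2 - q))))) := by
        gcongr
        rw [← ENNReal.ofReal_mul (by positivity), show b + 1 - (q - 1) = b + 2 - q by ring]
        apply ENNReal.ofReal_le_ofReal
        exact rpow_le_of_comparable _ (by linarith) (by nlinarith) (by nlinarith) (by nlinarith)
    _ = _ := by
        push_cast
        simp only [ENNReal.ofReal]
        ring

/-- At x = 1 the radial integrand is s^(b+1-q), integrable at 0 because q < b + 2. -/
lemma lintegral_area_one_sub_lt_top {b q : ℝ} (hb : -1 < b) (hq : 1 < q) (hqb : q < b + 2) :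
    ∫⁻ w, ENNReal.ofReal (‖1 - w‖ ^ (-q)) ∂area b < ⊤ := by
  obtain ⟨C₁, h₁⟩ := lintegral_disk_kernel_real_le hq b
  have h := lintegral_area_kernel 1 hb q
  simp only [map_one, one_mul] at h
  rw [h, norm_one]
  refine ENNReal.mul_lt_top ENNReal.ofReal_lt_top
    ((h₁ 1 zero_le_one le_rfl).trans_lt (ENNReal.mul_lt_top ENNReal.coe_lt_top ?_))
  refine lt_of_le_of_lt (le_of_eq_of_le ?_ (lintegral_mono_set Set.Ioo_subset_Ioc_self))
    (lt_of_eq_of_lt (lintegral_rpow_Ioo (b := b + (1 - q)) (d := 1) (by linarith) one_pos)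
      ENNReal.ofReal_lt_top)
  refine setLIntegral_congr_fun measurableSet_Ioo fun s hs => ?_
  simp only [sub_self, add_zero]
  rw [Real.rpow_add hs.1]

/-! ### Local means -/

instance (b : ℝ) : SFinite (area b) := by
  unfold area; infer_instance

lemma ae_area_mem_disk (b : ℝ) : ∀ᵐ z ∂area b, z ∈ disk :=
  (withDensity_absolutelyContinuous _ _).ae_le (ae_restrict_mem isOpen_disk.measurableSet)

open Classical in
/-- The normalized indicator of the Euclidean ball about `z` of radius `3 / 4` of the distance of
`z` to the unit circle. -/
noncomputable def localKernel (z u : ℂ) : ℝ≥0∞ :=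
  if dist u z < 3 / 4 * (1 - ‖z‖) then ENNReal.ofReal (16 / (Real.pi * (1 - ‖z‖) ^ 2)) else 0

lemma localKernel_of_lt {z u : ℂ} (h : dist u z < 3 / 4 * (1 - ‖z‖)) :
    localKernel z u = ENNReal.ofReal (16 / (Real.pi * (1 - ‖z‖) ^ 2)) := if_pos h

lemma localKernel_of_not_lt {z u : ℂ} (h : ¬ dist u z < 3 / 4 * (1 - ‖z‖)) :
    localKernel z u = 0 := if_neg h

lemma measurable_localKernel : Measurable fun x : ℂ × ℂ => localKernel x.1 x.2 := by
  refine Measurable.ite (measurableSet_lt ?_ ?_) ?_ measurable_const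
  · fun_prop
  · fun_prop
  · fun_prop

/-- The integral of `G` against `localKernel z`. -/
noncomputable def localMean (G : ℂ → ℝ≥0∞) (z : ℂ) : ℝ≥0∞ := ∫⁻ u, localKernel z u * G u

lemma measurable_localKernel_mul {G : ℂ → ℝ≥0∞} (hG : Measurable G) :
    Measurable fun x : ℂ × ℂ => localKernel x.1 x.2 * G x.2 :=
  measurable_localKernel.mul (hG.comp measurable_snd)

lemma measurable_localMean {G : ℂ → ℝ≥0∞} (hG : Measurable G) : Measurable (localMean G) :=
  (measurable_localKernel_mul hG).lintegral_prod_right'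

/-- The ball of radius (1 - |z|)/4 about v lies within 3/4 (1 - |z|) of z. Hence a single mean
dominates |f|^p on the whole half-size ball, the uniformity needed for the Schwarz lemma. -/
lemma le_localMean {f : ℂ → ℂ} (hf : DifferentiableOn ℂ f disk) {p : ℝ} (hp : 1 < p) {z v : ℂ}
    (hz : z ∈ disk) (hv : v ∈ Metric.ball z ((1 - ‖z‖) / 2)) :
    ‖f v‖ₑ ^ p ≤ localMean (disk.indicator fun u => ‖f u‖ₑ ^ p) z := by
  have hd : 0 < 1 - ‖z‖ := by linarith [mem_disk.1 hz]
  rw [Metric.mem_ball] at hv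
  have hsub : Metric.ball v ((1 - ‖z‖) / 4) ⊆ disk := by
    intro u hu
    rw [Metric.mem_ball] at hu
    rw [mem_disk]
    have h1 : dist u 0 ≤ dist u v + (dist v z + dist z 0) :=
      (dist_triangle u v 0).trans (by gcongr; exact dist_triangle v z 0)
    rw [dist_zero_right, dist_zero_right] at h1
    linarith
  refine (enorm_rpow_le_lintegral_ball (by linarith) hp (hf.mono hsub)).trans ?_
  rw [← lintegral_const_mul' _ _ ENNReal.ofReal_ne_top, localMean,
    ← lintegral_indicator measurableSet_ball]
  refine lintegral_mono fun u => ?_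
  by_cases hu : u ∈ Metric.ball v ((1 - ‖z‖) / 4)
  · have h1 : dist u z < 3 / 4 * (1 - ‖z‖) := by
      have := dist_triangle u v z
      rw [Metric.mem_ball] at hu
      linarith
    have h2 : 1 / (Real.pi * ((1 - ‖z‖) / 4) ^ 2) = 16 / (Real.pi * (1 - ‖z‖) ^ 2) := by
      field_simp
      norm_num
    rw [Set.indicator_of_mem hu, Set.indicator_of_mem (hsub hu), localKernel_of_lt h1, h2]
  · simp [hu]

/-! ### Pointwise bounds for the lift -/

lemma norm_one_sub_conj_mul_le {z w : ℂ} (hz : z ∈ disk) :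
    ‖1 - (starRingEnd ℂ) z * w‖ ≤ 2 * (1 - ‖z‖) + dist w z := by
  have hz1 := mem_disk.1 hz
  have h1 : 1 - (starRingEnd ℂ) z * w = (1 - (starRingEnd ℂ) z * z) - (starRingEnd ℂ) z * (w - z) := by
    ring
  have h2 : ‖1 - (starRingEnd ℂ) z * z‖ = 1 - ‖z‖ ^ 2 := by
    rw [mul_comm, Complex.mul_conj, Complex.normSq_eq_norm_sq, ← Complex.ofReal_one,
      ← Complex.ofReal_sub, Complex.norm_real, Real.norm_of_nonneg]
    nlinarith [norm_nonneg z]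
  rw [h1]
  refine (norm_sub_le _ _).trans ?_
  rw [h2, norm_mul, RCLike.norm_conj, dist_eq_norm]
  nlinarith [norm_nonneg z, norm_nonneg (w - z)]

lemma norm_one_sub_conj_mul_pos {z w : ℂ} (hz : z ∈ disk) (hw : w ∈ disk) :
    0 < ‖1 - (starRingEnd ℂ) z * w‖ := by
  have hz1 := mem_disk.1 hz
  have hw1 := mem_disk.1 hw
  have h := norm_sub_norm_le (1 : ℂ) ((starRingEnd ℂ) z * w)
  rw [norm_mul, RCLike.norm_conj, norm_one] at h
  nlinarith [norm_nonneg z, norm_nonneg w]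

/-- Near the diagonal the lift is controlled by a local mean. -/
lemma enorm_lift_le_near {f : ℂ → ℂ} (hf : DifferentiableOn ℂ f disk) {p : ℝ} (hp : 1 < p)
    {z w : ℂ} (hz : z ∈ disk) (hw : w ∈ disk) (hzw : w ∈ Metric.ball z ((1 - ‖z‖) / 2)) :
    ‖lift f (z, w)‖ₑ ≤ 10 * localMean (disk.indicator fun u => ‖f u‖ₑ ^ p) z ^ p⁻¹ *
      ENNReal.ofReal (‖1 - (starRingEnd ℂ) z * w‖⁻¹) := by
  set M := localMean (disk.indicator fun u => ‖f u‖ₑ ^ p) z with hM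
  have hd : 0 < 1 - ‖z‖ := by linarith [mem_disk.1 hz]
  have hN := norm_one_sub_conj_mul_pos hz hw
  have hp0 : 0 < p := by linarith
  -- An infinite mean makes the bound trivial; otherwise `S` is a real bound for |f| near z.
  by_cases hMt : M = ⊤
  · rw [hMt, ENNReal.top_rpow_of_pos (by positivity), ENNReal.mul_top (by norm_num),
      ENNReal.top_mul]
    · exact le_top
    · simpa [ENNReal.ofReal_eq_zero] using hN
  have hMp : M ^ p⁻¹ ≠ ⊤ := by simp [hMt, hp0.le]
  set S := (M ^ p⁻¹).toReal with hS
  have hSM : ENNReal.ofReal S = M ^ p⁻¹ := ENNReal.ofReal_toReal hMp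
  have hbd : ∀ v ∈ Metric.ball z ((1 - ‖z‖) / 2), ‖f v‖ ≤ S := by
    intro v hv
    have h1 := le_localMean hf hp hz hv
    rw [← ENNReal.le_rpow_inv_iff hp0, ← hM, ← hSM, ← ofReal_norm] at h1
    exact (ENNReal.ofReal_le_ofReal_iff ENNReal.toReal_nonneg).1 h1
  have hsub : Metric.ball z ((1 - ‖z‖) / 2) ⊆ disk := by
    intro u hu
    rw [Metric.mem_ball] at hu
    rw [mem_disk]
    have := dist_triangle u z 0
    rw [dist_zero_right, dist_zero_right] at this
    linarith
  have hmaps : Set.MapsTo f (Metric.ball z ((1 - ‖z‖) / 2)) (Metric.closedBall (f z) (2 * S)) := by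
    intro v hv
    rw [Metric.mem_closedBall, dist_eq_norm]
    have := norm_sub_le (f v) (f z)
    linarith [hbd v hv, hbd z (Metric.mem_ball_self (by linarith))]
  -- Schwarz lemma: the slope is at most 2S / ((1 - |z|)/2) = 4S / (1 - |z|). Since |1 - z̄w| ≤
  -- (5/2)(1 - |z|) here, the constant is 10.
  have h2 := Complex.norm_dslope_le_div_of_mapsTo_ball (hf.mono hsub) hmaps hzw
  have h3 : ‖lift f (z, w)‖ ≤ 10 * S * ‖1 - (starRingEnd ℂ) z * w‖⁻¹ := by
    rw [lift_eq_dslope]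
    refine h2.trans ?_
    rw [← div_eq_mul_inv, div_le_div_iff₀ (by linarith) hN]
    have h4 := norm_one_sub_conj_mul_le (w := w) hz
    rw [Metric.mem_ball] at hzw
    have hS0 : 0 ≤ S := ENNReal.toReal_nonneg
    nlinarith
  rw [← ofReal_norm, ← hSM]
  refine (ENNReal.ofReal_le_ofReal h3).trans (le_of_eq ?_)
  rw [ENNReal.ofReal_mul (by positivity), ENNReal.ofReal_mul (by norm_num)]
  norm_num

/-- Here 1 - |z| ≤ 2|z - w|, so |1 - z̄w| ≤ 2(1 - |z|) + |z - w| ≤ 5|z - w|. -/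
lemma enorm_lift_le_far {f : ℂ → ℂ} {z w : ℂ} (hz : z ∈ disk) (hw : w ∈ disk)
    (hzw : w ∉ Metric.ball z ((1 - ‖z‖) / 2)) :
    ‖lift f (z, w)‖ₑ ≤ 5 * (‖f z‖ₑ + ‖f w‖ₑ) *
      ENNReal.ofReal (‖1 - (starRingEnd ℂ) z * w‖⁻¹) := by
  have hd : 0 < 1 - ‖z‖ := by linarith [mem_disk.1 hz]
  have hN := norm_one_sub_conj_mul_pos hz hw
  rw [Metric.mem_ball, not_lt] at hzw
  have hne : z ≠ w := by
    rintro rfl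
    rw [dist_self] at hzw
    linarith
  have h1 := norm_one_sub_conj_mul_le (w := w) hz
  have hzw' : 0 < ‖z - w‖ := norm_pos_iff.2 (sub_ne_zero.2 hne)
  have h3 : ‖lift f (z, w)‖ ≤ 5 * (‖f z‖ + ‖f w‖) * ‖1 - (starRingEnd ℂ) z * w‖⁻¹ := by
    simp only [lift, hne, if_false, norm_div]
    rw [← div_eq_mul_inv, div_le_div_iff₀ hzw' hN]
    have h4 := norm_sub_le (f z) (f w)
    rw [dist_comm, dist_eq_norm] at h1 hzw
    have h5 : ‖1 - (starRingEnd ℂ) z * w‖ ≤ 5 * ‖z - w‖ := by linarith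
    calc _ ≤ (‖f z‖ + ‖f w‖) * (5 * ‖z - w‖) := by gcongr
      _ = _ := by ring
  rw [← ofReal_norm, ← ofReal_norm, ← ofReal_norm, ← ENNReal.ofReal_add (by positivity)
    (by positivity)]
  refine (ENNReal.ofReal_le_ofReal h3).trans (le_of_eq ?_)
  rw [ENNReal.ofReal_mul (by positivity), ENNReal.ofReal_mul (by norm_num)]
  norm_num

/-- Replacing |f(z)|^p by its local mean in the far case gives one majorant for both cases. -/
lemma enorm_lift_rpow_le {f : ℂ → ℂ} (hf : DifferentiableOn ℂ f disk) {p : ℝ} (hp : 1 < p)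
    {z w : ℂ} (hz : z ∈ disk) (hw : w ∈ disk) :
    ‖lift f (z, w)‖ₑ ^ p ≤ 10 ^ p * (localMean (disk.indicator fun u => ‖f u‖ₑ ^ p) z +
      disk.indicator (fun u => ‖f u‖ₑ ^ p) w) *
      ENNReal.ofReal (‖1 - (starRingEnd ℂ) z * w‖ ^ (-p)) := by
  have hN := norm_one_sub_conj_mul_pos hz hw
  have hp0 : 0 < p := by linarith
  have hd : 0 < 1 - ‖z‖ := by linarith [mem_disk.1 hz]
  have hk : ENNReal.ofReal (‖1 - (starRingEnd ℂ) z * w‖ ^ (-p)) =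
      ENNReal.ofReal (‖1 - (starRingEnd ℂ) z * w‖⁻¹) ^ p := by
    rw [ENNReal.ofReal_rpow_of_pos (by positivity), Real.rpow_neg hN.le, Real.inv_rpow hN.le]
  rw [hk, Set.indicator_of_mem hw]
  by_cases hzw : w ∈ Metric.ball z ((1 - ‖z‖) / 2)
  · refine (ENNReal.rpow_le_rpow (enorm_lift_le_near hf hp hz hw hzw) hp0.le).trans ?_
    rw [ENNReal.mul_rpow_of_nonneg _ _ hp0.le, ENNReal.mul_rpow_of_nonneg _ _ hp0.le,
      ENNReal.rpow_inv_rpow hp0.ne']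
    gcongr
    exact le_self_add
  · refine (ENNReal.rpow_le_rpow (enorm_lift_le_far hz hw hzw) hp0.le).trans ?_
    rw [ENNReal.mul_rpow_of_nonneg _ _ hp0.le, ENNReal.mul_rpow_of_nonneg _ _ hp0.le]
    gcongr ?_ * _
    calc (5 : ℝ≥0∞) ^ p * (‖f z‖ₑ + ‖f w‖ₑ) ^ p
        ≤ 5 ^ p * (2 ^ (p - 1) * (‖f z‖ₑ ^ p + ‖f w‖ₑ ^ p)) := by
          gcongr
          exact ENNReal.rpow_add_le_mul_rpow_add_rpow _ _ hp.le
      _ ≤ 5 ^ p * (2 ^ p * (‖f z‖ₑ ^ p + ‖f w‖ₑ ^ p)) := by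
          gcongr
          · norm_num
          · linarith
      _ = 10 ^ p * (‖f z‖ₑ ^ p + ‖f w‖ₑ ^ p) := by
          rw [← mul_assoc, ← ENNReal.mul_rpow_of_nonneg _ _ hp0.le]
          norm_num
      _ ≤ _ := by
          gcongr
          exact le_localMean hf hp hz (Metric.mem_ball_self (by linarith))

/-! ### Boundedness of the lifting operator -/

/-- After Tonelli, fix u: if `localKernel z u` is nonzero, then 1 - |z| and 1 - |u| agree up to a
factor 4, so the weights are comparable and z lies in a ball about u of area O((1 - |u|)^2), which
cancels the normalization. -/
lemma lintegral_localMean_le {b : ℝ} (hb : -1 < b) :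
    ∃ C : ℝ≥0, ∀ G : ℂ → ℝ≥0∞, Measurable G → (∀ u ∉ disk, G u = 0) →
      ∫⁻ z, localMean G z ∂area b ≤ C * ∫⁻ u, G u ∂area b := by
  classical
  -- 8 compares the values of 1 - |·|^2; 2304 = 256 · 9, with 256 = 16 · 4^2 from the kernel and 9
  -- from the radius 3(1 - |u|).
  refine ⟨Real.toNNReal (8 ^ |b| * 2304), fun G hG hG0 => ?_⟩
  unfold localMean
  rw [lintegral_lintegral_swap (measurable_localKernel_mul hG).aemeasurable, lintegral_area,
    ← lintegral_indicator isOpen_disk.measurableSet, ← lintegral_const_mul' _ _ ENNReal.coe_ne_top]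
  refine lintegral_mono fun u => ?_
  by_cases hu : u ∈ disk
  swap
  · simp [hG0 u hu]
  rw [Set.indicator_of_mem hu, lintegral_mul_const, ← mul_assoc]
  swap
  · exact measurable_localKernel.comp (measurable_id.prodMk measurable_const)
  gcongr
  rw [lintegral_area, ← lintegral_indicator isOpen_disk.measurableSet]
  have hu1 := mem_disk.1 hu
  have hu0 := norm_nonneg u
  have hc : 0 ≤ (b + 1) / Real.pi := div_nonneg (by linarith) Real.pi_pos.le
  set W := (b + 1) / Real.pi * (1 - ‖u‖ ^ 2) ^ b with hW
  have hω : 0 < 1 - ‖u‖ ^ 2 := by nlinarith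
  have hW0 : 0 ≤ W := by positivity
  have hdu : 0 < 1 - ‖u‖ := by linarith
  calc _ ≤ ∫⁻ z, (Metric.ball u (3 * (1 - ‖u‖))).indicator
        (fun _ => ENNReal.ofReal (8 ^ |b| * W * (256 / (Real.pi * (1 - ‖u‖) ^ 2)))) z := by
        refine lintegral_mono fun z => ?_
        by_cases hz : z ∈ disk
        swap
        · simp [hz]
        rw [Set.indicator_of_mem hz]
        by_cases huz : dist u z < 3 / 4 * (1 - ‖z‖)
        swap
        · simp [localKernel_of_not_lt huz]
        have hz1 := mem_disk.1 hz
        have hz0 := norm_nonneg z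
        have hdz : 0 < 1 - ‖z‖ := by linarith
        have k1 := abs_le.1 (abs_norm_sub_norm_le u z)
        rw [← dist_eq_norm] at k1
        have k2 : 1 - ‖z‖ ≤ 4 * (1 - ‖u‖) := by linarith [k1.1, k1.2]
        have k3 : 1 - ‖u‖ ≤ 4 * (1 - ‖z‖) := by linarith [k1.1, k1.2]
        rw [Set.indicator_of_mem (by rw [Metric.mem_ball, dist_comm]; linarith)]
        rw [localKernel_of_lt huz]
        have hωz : 0 < 1 - ‖z‖ ^ 2 := by nlinarith
        rw [← ENNReal.ofReal_mul (by positivity)]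
        apply ENNReal.ofReal_le_ofReal
        have k4 : (1 - ‖z‖ ^ 2) ^ b ≤ 8 ^ |b| * (1 - ‖u‖ ^ 2) ^ b :=
          rpow_le_of_comparable b hωz hω (by nlinarith) (by nlinarith)
        have k5 : 16 / (Real.pi * (1 - ‖z‖) ^ 2) ≤ 256 / (Real.pi * (1 - ‖u‖) ^ 2) := by
          rw [div_le_div_iff₀ (by positivity) (by positivity)]
          have : (1 - ‖u‖) ^ 2 ≤ (4 * (1 - ‖z‖)) ^ 2 := by gcongr
          nlinarith [Real.pi_pos]
        calc _ ≤ (b + 1) / Real.pi * (8 ^ |b| * (1 - ‖u‖ ^ 2) ^ b) *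
              (256 / (Real.pi * (1 - ‖u‖) ^ 2)) := by gcongr
          _ = _ := by rw [hW]; ring
    _ = ENNReal.ofReal (8 ^ |b| * W * (256 / (Real.pi * (1 - ‖u‖) ^ 2))) *
        ENNReal.ofReal (Real.pi * (3 * (1 - ‖u‖)) ^ 2) := by
        rw [lintegral_indicator measurableSet_ball, setLIntegral_const,
          volume_ball_eq u (by linarith)]
    _ = _ := by
        rw [← ENNReal.ofReal_mul (by positivity)]
        change _ = ENNReal.ofReal _ * _
        rw [← ENNReal.ofReal_mul (by positivity)]
        congr 1
        field_simp
        ring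

/-- The relation defining β enters here as β + (β + 2 - p) = α. -/
lemma lintegral_mul_weight_eq {α β p : ℝ} (hα : -1 < α) (hβ' : -1 < β)
    (hβ : 2 * (β + 1) = p + α) (H : ℂ → ℝ≥0∞) :
    ∫⁻ z, H z * ENNReal.ofReal ((1 - ‖z‖ ^ 2) ^ (β + 2 - p)) ∂area β =
      ENNReal.ofReal ((β + 1) / (α + 1)) * ∫⁻ z, H z ∂area α := by
  rw [lintegral_area, lintegral_area, ← lintegral_const_mul' _ _ ENNReal.ofReal_ne_top]
  refine setLIntegral_congr_fun isOpen_disk.measurableSet fun z hz => ?_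
  have hz1 := mem_disk.1 hz
  have hω : 0 < 1 - ‖z‖ ^ 2 := by nlinarith [norm_nonneg z]
  have hβ1 : 0 < β + 1 := by linarith
  have hα1 : 0 < α + 1 := by linarith
  rw [mul_comm (H z), ← mul_assoc, ← mul_assoc, ← ENNReal.ofReal_mul (by positivity),
    ← ENNReal.ofReal_mul (by positivity)]
  congr 2
  rw [mul_assoc, ← Real.rpow_add hω, show β + (β + 2 - p) = α by linarith]
  field_simp

lemma lintegral_mul_kernel_le {α β p : ℝ} (hα : -1 < α) (hp : α + 2 < p)
    (hβ : 2 * (β + 1) = p + α) :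
    ∃ C : ℝ≥0, ∀ H : ℂ → ℝ≥0∞,
      ∫⁻ z, H z * ∫⁻ w, ENNReal.ofReal (‖1 - (starRingEnd ℂ) z * w‖ ^ (-p)) ∂area β ∂area β ≤
        C * ∫⁻ z, H z ∂area α := by
  have hβ' : -1 < β := by linarith
  obtain ⟨C, hC⟩ := lintegral_area_kernel_le (b := β) (q := p) hβ' (by linarith)
  refine ⟨C * Real.toNNReal ((β + 1) / (α + 1)), fun H => ?_⟩
  calc _ ≤ ∫⁻ z, C * (H z * ENNReal.ofReal ((1 - ‖z‖ ^ 2) ^ (β + 2 - p))) ∂area β := by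
        apply lintegral_mono_ae
        filter_upwards [ae_area_mem_disk β] with z hz
        calc _ ≤ H z * (C * ENNReal.ofReal ((1 - ‖z‖ ^ 2) ^ (β + 2 - p))) := by
              gcongr; exact hC z hz
          _ = _ := by ring
    _ = _ := by
        rw [lintegral_const_mul' _ _ ENNReal.coe_ne_top, lintegral_mul_weight_eq hα hβ' hβ]
        push_cast
        rw [ENNReal.ofReal]
        ring

lemma norm_one_sub_conj_mul_comm (z w : ℂ) :
    ‖1 - (starRingEnd ℂ) z * w‖ = ‖1 - (starRingEnd ℂ) w * z‖ := by
  rw [← RCLike.norm_conj]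
  simp [mul_comm]

lemma measurable_kernel (q : ℝ) :
    Measurable fun x : ℂ × ℂ => ENNReal.ofReal (‖1 - (starRingEnd ℂ) x.1 * x.2‖ ^ (-q)) := by
  have : Measurable fun z : ℂ => (starRingEnd ℂ) z := Complex.continuous_conj.measurable
  fun_prop

/-- The modulus of the kernel is symmetric, so after Tonelli the term in w is handled like the term
in z. -/
lemma lintegral_add_mul_kernel_le {α β p : ℝ} (hα : -1 < α) (hp : α + 2 < p)
    (hβ : 2 * (β + 1) = p + α) :
    ∃ C : ℝ≥0, ∀ M G : ℂ → ℝ≥0∞, Measurable M → Measurable G →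
      ∫⁻ z, ∫⁻ w, (M z + G w) * ENNReal.ofReal (‖1 - (starRingEnd ℂ) z * w‖ ^ (-p))
          ∂area β ∂area β ≤ C * (∫⁻ z, M z ∂area α + ∫⁻ z, G z ∂area α) := by
  obtain ⟨C, hC⟩ := lintegral_mul_kernel_le hα hp hβ
  refine ⟨C, fun M G hM hG => ?_⟩
  have hkm := measurable_kernel p
  have hkz : ∀ z : ℂ, Measurable fun w => ENNReal.ofReal (‖1 - (starRingEnd ℂ) z * w‖ ^ (-p)) :=
    fun z => by fun_prop
  have e1 : ∀ z, ∫⁻ w, (M z + G w) * ENNReal.ofReal (‖1 - (starRingEnd ℂ) z * w‖ ^ (-p)) ∂area β =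
      M z * ∫⁻ w, ENNReal.ofReal (‖1 - (starRingEnd ℂ) z * w‖ ^ (-p)) ∂area β +
      ∫⁻ w, G w * ENNReal.ofReal (‖1 - (starRingEnd ℂ) z * w‖ ^ (-p)) ∂area β := by
    intro z
    simp_rw [add_mul]
    rw [lintegral_add_left ((hkz z).const_mul _), lintegral_const_mul _ (hkz z)]
  have e2 : ∫⁻ z, ∫⁻ w, G w * ENNReal.ofReal (‖1 - (starRingEnd ℂ) z * w‖ ^ (-p))
        ∂area β ∂area β =
      ∫⁻ z, G z * ∫⁻ w, ENNReal.ofReal (‖1 - (starRingEnd ℂ) z * w‖ ^ (-p)) ∂area β ∂area β := by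
    rw [lintegral_lintegral_swap ((hG.comp measurable_snd).mul hkm).aemeasurable]
    refine lintegral_congr fun w => ?_
    simp_rw [norm_one_sub_conj_mul_comm _ w]
    rw [lintegral_const_mul _ (hkz w)]
  simp_rw [e1]
  have hm : Measurable fun z => M z *
      ∫⁻ w, ENNReal.ofReal (‖1 - (starRingEnd ℂ) z * w‖ ^ (-p)) ∂area β :=
    hM.mul hkm.lintegral_prod_right'
  rw [lintegral_add_left hm, e2, mul_add]
  exact add_le_add (hC M) (hC G)

/-- The integral form of the boundedness of the lifting operator. -/
lemma lintegral_lift_le {α β p : ℝ} (hα : -1 < α) (hp : α + 2 < p)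
    (hβ : 2 * (β + 1) = p + α) :
    ∃ C : ℝ≥0, ∀ f : ℂ → ℂ, DifferentiableOn ℂ f disk →
      ∫⁻ x, ‖lift f x‖ₑ ^ p ∂(area β).prod (area β) ≤ C * ∫⁻ z, ‖f z‖ₑ ^ p ∂area α := by
  obtain ⟨C₁, h₁⟩ := lintegral_add_mul_kernel_le hα hp hβ
  obtain ⟨C₂, h₂⟩ := lintegral_localMean_le hα
  have hp1 : 1 < p := by linarith
  have hp0 : 0 ≤ p := by linarith
  refine ⟨10 ^ p * C₁ * (C₂ + 1), fun f hf => ?_⟩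
  have hGm : Measurable (disk.indicator fun u => ‖f u‖ₑ ^ p) := by
    classical
    rw [← Set.piecewise_eq_indicator]
    refine ContinuousOn.measurable_piecewise ?_ continuousOn_const isOpen_disk.measurableSet
    exact ENNReal.continuous_rpow_const.comp_continuousOn hf.continuousOn.enorm
  have hG0 : ∀ u ∉ disk, disk.indicator (fun u => ‖f u‖ₑ ^ p) u = 0 :=
    fun u hu => Set.indicator_of_notMem hu _
  have hGf : ∫⁻ z, disk.indicator (fun u => ‖f u‖ₑ ^ p) z ∂area α = ∫⁻ z, ‖f z‖ₑ ^ p ∂area α := by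
    apply lintegral_congr_ae
    filter_upwards [ae_area_mem_disk α] with z hz
    rw [Set.indicator_of_mem hz]
  have h3 := h₂ _ hGm hG0
  have h4 := h₁ _ _ (measurable_localMean hGm) hGm
  rw [hGf] at h3 h4
  have htop : (10 : ℝ≥0∞) ^ p ≠ ⊤ := ENNReal.rpow_ne_top_of_nonneg hp0 (by norm_num)
  -- Only the inequality half of Tonelli is used; it needs no measurability of the lift, which is
  -- arbitrary off the bidisk.
  calc ∫⁻ x, ‖lift f x‖ₑ ^ p ∂(area β).prod (area β)
      ≤ ∫⁻ z, ∫⁻ w, ‖lift f (z, w)‖ₑ ^ p ∂area β ∂area β := lintegral_prod_le _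
    _ ≤ ∫⁻ z, 10 ^ p * ∫⁻ w, (localMean (disk.indicator fun u => ‖f u‖ₑ ^ p) z +
          disk.indicator (fun u => ‖f u‖ₑ ^ p) w) *
          ENNReal.ofReal (‖1 - (starRingEnd ℂ) z * w‖ ^ (-p)) ∂area β ∂area β := by
        apply lintegral_mono_ae
        filter_upwards [ae_area_mem_disk β] with z hz
        rw [← lintegral_const_mul' _ _ htop]
        apply lintegral_mono_ae
        filter_upwards [ae_area_mem_disk β] with w hw
        exact (enorm_lift_rpow_le hf hp1 hz hw).trans_eq (mul_assoc _ _ _)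
    _ ≤ 10 ^ p * (C₁ * (C₂ * ∫⁻ z, ‖f z‖ₑ ^ p ∂area α + ∫⁻ z, ‖f z‖ₑ ^ p ∂area α)) := by
        rw [lintegral_const_mul' _ _ htop]
        gcongr
        exact h4.trans (by gcongr)
    _ = _ := by
        push_cast
        rw [ENNReal.coe_rpow_of_nonneg _ hp0]
        push_cast
        ring

/-! ### Optimality of the exponent -/

/-- The test function `(1 - z)^(-s)`. -/
noncomputable def powerFun (s : ℝ) (z : ℂ) : ℂ := (1 - z) ^ ((-s : ℝ) : ℂ)

lemma norm_powerFun (s : ℝ) (z : ℂ) : ‖powerFun s z‖ = ‖1 - z‖ ^ (-s) :=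
  Complex.norm_cpow_real _ _

lemma differentiableOn_powerFun (s : ℝ) : DifferentiableOn ℂ (powerFun s) disk := by
  intro z hz
  have h1 : 1 - z ∈ Complex.slitPlane := by
    left
    have := (Complex.re_le_norm z).trans_lt (mem_disk.1 hz)
    simpa using this
  exact (((differentiableAt_id.const_sub 1).cpow_const h1)).differentiableWithinAt

lemma lintegral_powerFun_lt_top {α p q : ℝ} (hα : -1 < α) (hp : 0 < p) (hq : 1 < q)
    (hqα : q < α + 2) : ∫⁻ z, ‖powerFun (q / p) z‖ₑ ^ p ∂area α < ⊤ := by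
  refine lt_of_le_of_lt (le_of_eq ?_) (lintegral_area_one_sub_lt_top hα hq hqα)
  refine lintegral_congr fun z => ?_
  rw [← ofReal_norm, norm_powerFun, ENNReal.ofReal_rpow_of_nonneg (by positivity) hp.le,
    ← Real.rpow_mul (norm_nonneg _), neg_mul, div_mul_cancel₀ _ hp.ne']

lemma le_norm_one_sub_of_mem_ball {ε : ℝ} (hε : 0 < ε) {z : ℂ}
    (hz : z ∈ Metric.ball ((1 - ε : ℝ) : ℂ) (ε / 2)) :
    ε / 2 ≤ ‖1 - z‖ ∧ ‖1 - z‖ ≤ 3 * ε / 2 := by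
  rw [Metric.mem_ball, dist_eq_norm] at hz
  have h1 : 1 - z = (ε : ℂ) - (z - ((1 - ε : ℝ) : ℂ)) := by push_cast; ring
  have h2 : ‖(ε : ℂ)‖ = ε := by simp [abs_of_pos hε]
  rw [h1]
  constructor
  · have := norm_sub_norm_le (ε : ℂ) (z - ((1 - ε : ℝ) : ℂ))
    linarith
  · have := norm_sub_le (ε : ℂ) (z - ((1 - ε : ℝ) : ℂ))
    linarith

/-- Lower bound for the weighted area of a disk touching the point `1` nontangentially. -/
lemma le_area_ball {b : ℝ} (hb : -1 < b) :
    ∃ c : ℝ, 0 < c ∧ ∀ ε : ℝ, 0 < ε → ε ≤ 1 →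
      ENNReal.ofReal (c * ε ^ (b + 2)) ≤ area b (Metric.ball ((1 - ε : ℝ) : ℂ) (ε / 2)) := by
  have hb1 : 0 < b + 1 := by linarith
  refine ⟨(b + 1) / 4 * (3 ^ |b|)⁻¹, by positivity, fun ε hε hε1 => ?_⟩
  have hB : ∀ z ∈ Metric.ball ((1 - ε : ℝ) : ℂ) (ε / 2), ‖z‖ ≤ 1 - ε / 2 := by
    intro z hz
    rw [Metric.mem_ball] at hz
    have h1 := dist_triangle z ((1 - ε : ℝ) : ℂ) 0
    rw [dist_zero_right, dist_zero_right, Complex.norm_real, Real.norm_of_nonneg (by linarith)] at h1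
    linarith
  have hsub : Metric.ball ((1 - ε : ℝ) : ℂ) (ε / 2) ⊆ disk := fun z hz => by
    rw [mem_disk]
    linarith [hB z hz]
  rw [area, withDensity_apply _ measurableSet_ball, Measure.restrict_restrict measurableSet_ball,
    Set.inter_eq_left.2 hsub]
  calc _ = ∫⁻ _ in Metric.ball ((1 - ε : ℝ) : ℂ) (ε / 2),
        ENNReal.ofReal ((b + 1) / Real.pi * ((3 ^ |b|)⁻¹ * ε ^ b)) := by
        rw [setLIntegral_const, volume_ball_eq _ (by positivity),
          ← ENNReal.ofReal_mul (by positivity)]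
        congr 1
        rw [Real.rpow_add hε, Real.rpow_two]
        field_simp
        ring
    _ ≤ _ := by
        refine setLIntegral_mono' measurableSet_ball fun z hz => ENNReal.ofReal_le_ofReal ?_
        have h1 := hB z hz
        have h2 := (le_norm_one_sub_of_mem_ball hε hz).2
        have h3 := norm_sub_norm_le 1 z
        rw [norm_one] at h3
        have hz0 := norm_nonneg z
        gcongr
        rw [inv_mul_le_iff₀ (by positivity)]
        exact rpow_le_of_comparable b hε (by nlinarith) (by nlinarith) (by nlinarith)

/-- Lower bound for the lift of the test function away from the diagonal. -/
lemma le_norm_lift_powerFun {s : ℝ} (hs : 0 < s) :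
    ∃ c K : ℝ, 0 < c ∧ 1 ≤ K ∧ ∀ ε : ℝ, 0 < ε →
      ∀ z ∈ Metric.ball ((1 - ε : ℝ) : ℂ) (ε / 2),
      ∀ w ∈ Metric.ball ((1 - K * ε : ℝ) : ℂ) (K * ε / 2),
        c * ε ^ (-s - 1) ≤ ‖lift (powerFun s) (z, w)‖ := by
  -- Chosen so that κ^(-s) = 1/2: then |1 - w| ≥ κ|1 - z| gives |f(w)| ≤ |f(z)|/2. Taking K = 3κ
  -- ensures this, as |1 - w| ≥ Kε/2 and |1 - z| ≤ 3ε/2.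
  set κ : ℝ := 2 ^ s⁻¹ with hκ
  have hκ1 : 1 ≤ κ := Real.one_le_rpow (by norm_num) (by positivity)
  have hκ1' : 1 < κ := Real.one_lt_rpow (by norm_num) (by positivity)
  refine ⟨(3 / 2) ^ (-s) / (6 * (3 * κ)), 3 * κ, by positivity, by linarith,
    fun ε hε z hz w hw => ?_⟩
  have hKε : 0 < 3 * κ * ε := by positivity
  obtain ⟨z1, z2⟩ := le_norm_one_sub_of_mem_ball hε hz
  obtain ⟨w1, w2⟩ := le_norm_one_sub_of_mem_ball hKε hw
  have ha : 0 < ‖1 - z‖ := by linarith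
  have hab : κ * ‖1 - z‖ ≤ ‖1 - w‖ := by nlinarith
  have hne : z ≠ w := by
    rintro rfl
    nlinarith
  have hzw : ‖z - w‖ ≤ 3 * (3 * κ) * ε := by
    have h1 := norm_sub_le (1 - w) (1 - z)
    rw [sub_sub_sub_cancel_left] at h1
    nlinarith
  have hzw0 : 0 < ‖z - w‖ := norm_pos_iff.2 (sub_ne_zero.2 hne)
  have hfw : ‖powerFun s w‖ ≤ ‖1 - z‖ ^ (-s) / 2 := by
    rw [norm_powerFun]
    refine (Real.rpow_le_rpow_of_nonpos (by positivity) hab (by linarith)).trans (le_of_eq ?_)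
    rw [Real.mul_rpow (by positivity) ha.le, hκ, ← Real.rpow_mul (by norm_num), mul_neg,
      inv_mul_cancel₀ hs.ne', Real.rpow_neg_one]
    ring
  have hfz : (3 / 2) ^ (-s) * ε ^ (-s) ≤ ‖1 - z‖ ^ (-s) := by
    rw [← Real.mul_rpow (by norm_num) hε.le]
    exact Real.rpow_le_rpow_of_nonpos ha (by linarith) (by linarith)
  have hdiff : (3 / 2) ^ (-s) * ε ^ (-s) / 2 ≤ ‖powerFun s z - powerFun s w‖ := by
    have h1 := norm_sub_norm_le (powerFun s z) (powerFun s w)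
    rw [norm_powerFun s z] at h1
    linarith
  simp only [lift, hne, if_false, norm_div]
  rw [le_div_iff₀ hzw0]
  refine le_trans ?_ hdiff
  calc _ ≤ (3 / 2) ^ (-s) / (6 * (3 * κ)) * ε ^ (-s - 1) * (3 * (3 * κ) * ε) := by gcongr
    _ = (3 / 2) ^ (-s) * (ε ^ (-s - 1) * ε) / 2 := by field_simp; norm_num
    _ = _ := by
      rw [Real.rpow_sub_one hε.ne', div_mul_cancel₀ _ hε.ne']

/-- The lift of the test function fails to be integrable for large exponents. -/
lemma lintegral_lift_powerFun_eq_top {γ p q : ℝ} (hγ : -1 < γ) (hp : 0 < p) (hq : 0 < q)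
    (hqγ : 2 * γ + 4 < q + p) :
    ∫⁻ x, ‖lift (powerFun (q / p)) x‖ₑ ^ p ∂(area γ).prod (area γ) = ⊤ := by
  obtain ⟨c, K, hc, hK, h1⟩ := le_norm_lift_powerFun (s := q / p) (by positivity)
  obtain ⟨c', hc', h2⟩ := le_area_ball hγ
  have hK0 : 0 < K := by linarith
  set I := ∫⁻ x, ‖lift (powerFun (q / p)) x‖ₑ ^ p ∂(area γ).prod (area γ) with hI
  -- The p-th power of the lift contributes ε^(-q-p), and each of the two balls contributes ε^(γ+2).
  have key : ∀ ε : ℝ, 0 < ε → K * ε ≤ 1 →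
      ENNReal.ofReal (c ^ p * c' ^ 2 * K ^ (γ + 2) * ε ^ (2 * γ + 4 - q - p)) ≤ I := by
    intro ε hε hKε
    have hε1 : ε ≤ 1 := by nlinarith
    set B₁ := Metric.ball ((1 - ε : ℝ) : ℂ) (ε / 2)
    set B₂ := Metric.ball ((1 - K * ε : ℝ) : ℂ) (K * ε / 2)
    calc _ = ENNReal.ofReal ((c * ε ^ (-(q / p) - 1)) ^ p) *
          (ENNReal.ofReal (c' * ε ^ (γ + 2)) * ENNReal.ofReal (c' * (K * ε) ^ (γ + 2))) := by
          rw [← ENNReal.ofReal_mul (by positivity), ← ENNReal.ofReal_mul (by positivity)]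
          congr 1
          have e1 : (-(q / p) - 1) * p = -q - p := by field_simp
          rw [Real.mul_rpow hc.le (by positivity), Real.mul_rpow hK0.le hε.le,
            ← Real.rpow_mul hε.le, e1,
            show 2 * γ + 4 - q - p = (-q - p) + ((γ + 2) + (γ + 2)) by ring, Real.rpow_add hε,
            Real.rpow_add hε (γ + 2) (γ + 2)]
          generalize ε ^ (γ + 2) = u
          generalize K ^ (γ + 2) = v
          generalize ε ^ (-q - p) = t
          ring
      _ ≤ ENNReal.ofReal ((c * ε ^ (-(q / p) - 1)) ^ p) * (area γ B₁ * area γ B₂) := by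
          gcongr
          · exact h2 ε hε hε1
          · exact h2 (K * ε) (by positivity) hKε
      _ = ∫⁻ _ in B₁ ×ˢ B₂, ENNReal.ofReal ((c * ε ^ (-(q / p) - 1)) ^ p)
            ∂(area γ).prod (area γ) := by
          rw [setLIntegral_const, Measure.prod_prod]
      _ ≤ ∫⁻ x in B₁ ×ˢ B₂, ‖lift (powerFun (q / p)) x‖ₑ ^ p ∂(area γ).prod (area γ) := by
          refine setLIntegral_mono' (measurableSet_ball.prod measurableSet_ball) fun x hx => ?_
          rw [← ENNReal.ofReal_rpow_of_nonneg (by positivity) hp.le, ← ofReal_norm]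
          gcongr
          exact h1 ε hε x.1 hx.1 x.2 hx.2
      _ ≤ I := setLIntegral_le_lintegral _ _
  by_contra hItop
  set A := c ^ p * c' ^ 2 * K ^ (γ + 2) with hA
  have hA0 : 0 < A := by positivity
  -- With t = 1/ε the lower bound is a positive power of t, so it exceeds any finite value of `I`.
  have hlim : Filter.Tendsto (fun t : ℝ => A * t ^ (q + p - (2 * γ + 4))) Filter.atTop
      Filter.atTop :=
    (tendsto_rpow_atTop (by linarith)).const_mul_atTop hA0
  obtain ⟨t, ht, htK⟩ := ((hlim.eventually_gt_atTop I.toReal).and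
    (Filter.eventually_ge_atTop K)).exists
  have ht0 : 0 < t := by linarith
  have h3 := key t⁻¹ (by positivity) (by rw [← div_eq_mul_inv, div_le_one ht0]; exact htK)
  rw [Real.inv_rpow ht0.le, ← Real.rpow_neg ht0.le,
    show -(2 * γ + 4 - q - p) = q + p - (2 * γ + 4) by ring,
    ENNReal.ofReal_le_iff_le_toReal hItop] at h3
  linarith

end Bergman

theorem theorem12 (α p β : ℝ) (hα : -1 < α) (hp : α + 2 < p) (hβ : 2 * (β + 1) = p + α) :
    (∃ C : ℝ≥0, ∀ f : ℂ → ℂ, Bergman.MemDisk p α f →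
      Bergman.MemBidisk p β (Bergman.lift f) ∧
        Bergman.bidiskNorm p β (Bergman.lift f) ≤ C * Bergman.diskNorm p α f) ∧
    (∀ γ : ℝ, -1 < γ → γ < β →
      ∃ f : ℂ → ℂ, Bergman.MemDisk p α f ∧ ¬ Bergman.MemBidisk p γ (Bergman.lift f)) := by
  have hp0 : 0 < p := by linarith
  constructor
  · obtain ⟨C, hC⟩ := Bergman.lintegral_lift_le hα hp hβ
    refine ⟨C ^ (1 / p), fun f hf => ⟨⟨Bergman.differentiableOn_lift hf.1,
      (hC f hf.1).trans_lt (ENNReal.mul_lt_top ENNReal.coe_lt_top hf.2)⟩, ?_⟩⟩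
    rw [Bergman.bidiskNorm, Bergman.diskNorm, ENNReal.coe_rpow_of_nonneg _ (by positivity),
      ← ENNReal.mul_rpow_of_nonneg _ _ (by positivity)]
    exact ENNReal.rpow_le_rpow (hC f hf.1) (by positivity)
  · intro γ hγ hγβ
    -- The interval is nonempty since 2γ + 4 - p < 2β + 4 - p = α + 2 and α > -1. The bound q > 1
    -- serves the angular integral in the norm of the test function.
    obtain ⟨q, hq1, hq2⟩ := exists_between (show max 1 (2 * γ + 4 - p) < α + 2 from
      max_lt (by linarith) (by linarith))
    obtain ⟨hq3, hq4⟩ := max_lt_iff.1 hq1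
    refine ⟨Bergman.powerFun (q / p), ⟨Bergman.differentiableOn_powerFun _,
      Bergman.lintegral_powerFun_lt_top hα hp0 hq3 hq2⟩, fun h => h.2.ne ?_⟩
    exact Bergman.lintegral_lift_powerFun_eq_top hγ hp0 (by linarith) (by linarith)
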